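/- Let $\mathbb K=\mathbb R$ or $\mathbb C$, let $n_{\mathbb K}:=\dim_{\mathbb R}\mathbb K^n$, embed $\mathbb K^n$ into $\mathbb{KP}^n$ by $x\mapsto[x:1]$, and let $\mathbf H_\infty:=\mathbb{KP}^n\setminus\mathbb K^n$ be the hyperplane at infinity. Identify $\mathbb K^n$ with the Euclidean space $\mathbb R^{n_{\mathbb K}}$. Definitions. For $N\ge 1$ the space $\mathbb R^N$ is compactified as a smooth manifold with boundary $\overline{\mathbb R^N}$, covered by the two charts $\mathbb R^N$ and $[0,\infty)\times\mathbb S^{N-1}$, which are glued along $(0,\infty)\times\mathbb S^{N-1}\to\mathbb R^N\setminus\{0\}$, $(r,u)\mapsto u/r$; its boundary is $\{0\}\times\mathbb S^{N-1}$. For $S\subset\mathbb R^N$ let $\overline S$ be its closure in $\overline{\mathbb R^N}$ and let $S^\infty\subset\mathbb S^{N-1}$ be defined by $\{0\}\times S^\infty=\overline S\cap(\{0\}\times\mathbb S^{N-1})$. A subset $P$ of a smooth manifold with boundary $(M,\partial M)$ is a p-submanifold if it is a smooth submanifold with boundary $\partial P$ of $M$, $\partial P=P\cap\partial M$, and $T_xP+T_x\partial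 M=T_xM$ for all $x\in\partial P$. The set $S$ is conic at $\infty$ if either $S$ is bounded, or $S^\infty\neq\emptyset$ and some open neighbourhood $W$ of $\{0\}\times S^\infty$ in $\overline{\mathbb R^N}$ is such that $\overline S\cap W$ is a p-submanifold of $W$. Lemma 4.2. Let $X$ be a closed connected smooth (real) submanifold, without boundary, of $\mathbb{KP}^n$ of real dimension $d$ with $0<d<n_{\mathbb K}$. Assume that $X\cap\mathbf H_\infty$ is not empty and that $X$ is transverse to $\mathbf H_\infty$, that is $T_xX+T_x\mathbf H_\infty=T_x\mathbb{KP}^n$ (as real vector spaces) for all $x\in X\cap\mathbf H_\infty$. Then the affine part $X\setminus\mathbf H_\infty\subset\mathbb K^n=\mathbb R^{n_{\mathbb K}}$ is conic at $\infty$. -/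

import Mathlib

open Set
open scoped ContDiff LinearAlgebra.Projectivization

noncomputable section

/-! ### Smooth submanifolds of a finite-dimensional real vector space -/

section Submanifolds

variable {V : Type*} [NormedAddCommGroup V] [NormedSpace ℝ V]

/-- `x` is an interior point of the `d`-dimensional submanifold with boundary `N` of `V`:
near `x` there is a smooth chart `Φ` of `V` which carries `N` onto the slice `ℝ^d × {0}` of
`ℝ^d × ℝ^c`. -/
def IsInteriorPoint (N : Set V) (d : ℕ) (x : V) : Prop :=
  x ∈ N ∧ ∃ (c : ℕ)
    (Φ : OpenPartialHomeomorph V (EuclideanSpace ℝ (Fin d) × EuclideanSpace ℝ (Fin c))),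
    x ∈ Φ.source ∧ ContDiffOn ℝ ∞ Φ Φ.source ∧ ContDiffOn ℝ ∞ Φ.symm Φ.target ∧
    N ∩ Φ.source = {y ∈ Φ.source | (Φ y).2 = 0}

/-- `x` is a boundary point of the `d`-dimensional submanifold with boundary `N` of `V`:
near `x` there is a smooth chart `Φ` of `V` which carries `N` onto the half slice
`([0,∞) × ℝ^k) × {0}` of `(ℝ × ℝ^k) × ℝ^c`, with `d = k + 1`, and `x` to a point of
`({0} × ℝ^k) × {0}`. -/
def IsBoundaryPoint (N : Set V) (d : ℕ) (x : V) : Prop :=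
  x ∈ N ∧ ∃ (k c : ℕ)
    (Φ : OpenPartialHomeomorph V
      ((ℝ × EuclideanSpace ℝ (Fin k)) × EuclideanSpace ℝ (Fin c))),
    d = k + 1 ∧
    x ∈ Φ.source ∧ ContDiffOn ℝ ∞ Φ Φ.source ∧ ContDiffOn ℝ ∞ Φ.symm Φ.target ∧
    N ∩ Φ.source = {y ∈ Φ.source | 0 ≤ (Φ y).1.1 ∧ (Φ y).2 = 0} ∧ (Φ x).1.1 = 0

/-- `N` is a smooth (embedded) `d`-dimensional submanifold, without boundary, of `V`. -/
def IsSmoothSubmanifold (N : Set V) (d : ℕ) : Prop :=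
  ∀ x ∈ N, IsInteriorPoint N d x

/-- `N` is a smooth (embedded) `d`-dimensional submanifold, with a possibly empty boundary,
of `V`. -/
def IsSmoothSubmanifoldWithBoundary (N : Set V) (d : ℕ) : Prop :=
  ∀ x ∈ N, IsInteriorPoint N d x ∨ IsBoundaryPoint N d x

/-- The boundary of the `d`-dimensional submanifold with boundary `N`. -/
def submanifoldBoundary (N : Set V) (d : ℕ) : Set V :=
  {x | IsBoundaryPoint N d x}

/-- The tangent space at `x` of a submanifold (possibly with boundary) `N` of `V`: the linear
span of all limits of `c_k • (x_k - x)` with `c_k ∈ ℝ`, `x_k ∈ N` and `x_k → x`.  At a boundary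
point this is the whole tangent space, not only a half space. -/
def tangentSubspace (N : Set V) (x : V) : Submodule ℝ V :=
  Submodule.span ℝ (tangentConeAt ℝ N x)

/-- Let `M` be a submanifold with boundary `bM` of `V`.  The set `N` is a `d`-dimensional
p-submanifold of `M`: it is a smooth submanifold with boundary contained in `M` (for subsets of
`M`, being a submanifold of `M` and being one of `V` are the same thing), its boundary points are
exactly its points on the boundary of `M`, and at these it is transverse to the boundary
of `M`. -/
def IsPSubmanifold (M bM N : Set V) (d : ℕ) : Prop :=
  N ⊆ M ∧ IsSmoothSubmanifoldWithBoundary N d ∧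
  submanifoldBoundary N d = N ∩ bM ∧
  ∀ x ∈ submanifoldBoundary N d,
    tangentSubspace N x ⊔ tangentSubspace bM x = tangentSubspace M x

end Submanifolds

/-! ### Compactification by a sphere at infinity, sets that are conic at infinity

The compactification of the Euclidean space `E` is covered by the two open charts `E` and
`[0,∞) × S`, with `S` the unit sphere of `E`; they are glued along `(0,∞) × S ≃ E \ {0}`,
`(r, u) ↦ u / r`, and the boundary is `{0} × S`.  Whatever happens near the boundary takes place in
the chart `[0,∞) × S`, a closed subset (and a submanifold with boundary) of `ℝ × E`. -/

section ConicAtInfinity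

variable {E : Type*} [NormedAddCommGroup E] [NormedSpace ℝ E]

variable (E) in
/-- The chart `[0,∞) × S` of the compactification at its boundary. -/
def chartAtInfinity : Set (ℝ × E) := Ici 0 ×ˢ Metric.sphere 0 1

variable (E) in
/-- The sphere at infinity `{0} × S`. -/
def sphereAtInfinity : Set (ℝ × E) := {0} ×ˢ Metric.sphere 0 1

/-- The trace on the chart `[0,∞) × S` of the closure of `X ⊆ E` in the compactification. As the
chart is open in the compactification and closed in `ℝ × E`, this is the closure in `ℝ × E` of
the set of all `(r, u)` with `r > 0`, `‖u‖ = 1` and `u / r ∈ X`. -/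
def closureAtInfinity (X : Set E) : Set (ℝ × E) :=
  closure {p | 0 < p.1 ∧ ‖p.2‖ = 1 ∧ p.1⁻¹ • p.2 ∈ X}

/-- The set `{0} × X^∞`, with `X^∞ ⊆ S` the asymptotic set of `X` at infinity. -/
def asymptoticSet (X : Set E) : Set (ℝ × E) :=
  closureAtInfinity X ∩ sphereAtInfinity E

/-- A subset `X` of the Euclidean space `E` is conic at infinity if it is bounded, or if the germ
of its closure along `{0} × X^∞` is non-empty and is the germ of a smooth p-submanifold of the
compactification. -/
def IsConicAtInfinity (X : Set E) : Prop :=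
  Bornology.IsBounded X ∨
    ((asymptoticSet X).Nonempty ∧
      ∃ W : Set (ℝ × E), IsOpen W ∧ asymptoticSet X ⊆ W ∧
        ∃ d : ℕ, IsPSubmanifold (chartAtInfinity E ∩ W) (sphereAtInfinity E ∩ W)
          (closureAtInfinity X ∩ W) d)

end ConicAtInfinity

/-! ### Projective space, its standard affine charts and its real submanifolds -/

section Projective

/-- The quotient topology on the projectivization of a topological vector space. -/
instance instTopologicalSpaceProjectivization (K V : Type*) [DivisionRing K] [AddCommGroup V]
    [Module K V] [TopologicalSpace V] : TopologicalSpace (ℙ K V) :=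
  TopologicalSpace.coinduced (Projectivization.mk' K : {v : V // v ≠ 0} → ℙ K V) inferInstance

variable {𝕂 : Type*} [RCLike 𝕂] {n : ℕ}

/-- The inverse of the `i`-th standard affine chart of `𝕂ℙⁿ`: it inserts the homogeneous coordinate
`1` at position `i`. For `i = n` it is the embedding `x ↦ [x : 1]` of `𝕂ⁿ`. -/
def affineEmbedding (i : Fin (n + 1)) (x : EuclideanSpace 𝕂 (Fin n)) :
    ℙ 𝕂 (Fin (n + 1) → 𝕂) :=
  Projectivization.mk 𝕂 (i.insertNth (1 : 𝕂) (fun j => x j)) (by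
    intro h
    simpa using congrFun h i)

variable (𝕂 n) in
/-- The hyperplane at infinity of `𝕂ℙⁿ`, the complement of `𝕂ⁿ`. -/
def hyperplaneAtInfinity : Set (ℙ 𝕂 (Fin (n + 1) → 𝕂)) :=
  (range (affineEmbedding (𝕂 := 𝕂) (Fin.last n)))ᶜ

/-- The affine part of `X ⊆ 𝕂ℙⁿ`, as a subset of `𝕂ⁿ`. -/
def affinePart (X : Set (ℙ 𝕂 (Fin (n + 1) → 𝕂))) : Set (EuclideanSpace 𝕂 (Fin n)) :=
  affineEmbedding (Fin.last n) ⁻¹' X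

/-- `X` is a smooth (embedded, without boundary) real submanifold of `𝕂ℙⁿ` of real dimension `d`:
it is one in each of the standard affine charts, where `𝕂ⁿ` is seen as a real vector space. -/
def IsProjectiveSubmanifold (X : Set (ℙ 𝕂 (Fin (n + 1) → 𝕂))) (d : ℕ) : Prop :=
  ∀ i : Fin (n + 1), IsSmoothSubmanifold (affineEmbedding i ⁻¹' X) d

/-- The submanifolds `X` and `Y` of `𝕂ℙⁿ` are transverse: at each common point their real tangent
spaces, read in the standard affine charts, together span the tangent space of `𝕂ℙⁿ`. -/
def ProjectiveTransverse (X Y : Set (ℙ 𝕂 (Fin (n + 1) → 𝕂))) : Prop :=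
  ∀ (i : Fin (n + 1)) (x : EuclideanSpace 𝕂 (Fin n)), affineEmbedding i x ∈ X ∩ Y →
    tangentSubspace (affineEmbedding i ⁻¹' X) x ⊔
      tangentSubspace (affineEmbedding i ⁻¹' Y) x = ⊤

end Projective

end

/-!
Let `C ⊆ 𝕂ⁿ⁺¹` be the cone over `X`. The point `u / r` belongs to the affine part of `X` exactly if
`(u, r) ∈ C`, and this condition makes sense for `r = 0` as well: the candidate for the closure at
infinity is `T = {(r, u) | 0 ≤ r, ‖u‖ = 1, (u, r) ∈ C}`, which is closed. Near each of its points
`C` is the zero set of a submersion `g`. Transversality to the hyperplane at infinity says that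
`g` remains a submersion on each slice `r = const`, so that `(r, g)` is a submersion, and since `C`
is a cone, `dg` vanishes in the radial direction, in which `‖u‖² - 1` has a non-zero derivative.
Hence `(r, ‖u‖² - 1, g)` is a submersion at the points of `T` with `r = 0`. So `T` has the boundary
`r = 0` there, meets the sphere at infinity transversely, and every such point is a limit of points
of `T` with `0 < r`, which shows that `T` is the closure of the affine part.
-/

open Filter Topology Module

section Submersions

variable {V W F G : Type*} [NormedAddCommGroup V] [NormedSpace ℝ V]
  [NormedAddCommGroup W] [NormedSpace ℝ W] [NormedAddCommGroup F] [NormedSpace ℝ F]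
  [NormedAddCommGroup G] [NormedSpace ℝ G]

/-- `g` is a smooth submersion at `x`. Smoothness is required on a neighbourhood of `x`, since
`ContDiffAt ℝ ∞ g x` only provides, for each finite order, a neighbourhood depending on that
order. -/
structure IsSmoothSubmersionAt (g : V → F) (x : V) : Prop where
  eventually_contDiffAt : ∀ᶠ y in 𝓝 x, ContDiffAt ℝ ∞ g y
  surjective_fderiv : Function.Surjective (fderiv ℝ g x)

namespace IsSmoothSubmersionAt

variable {g : V → F} {x : V}

theorem hasStrictFDerivAt (hg : IsSmoothSubmersionAt g x) :
    HasStrictFDerivAt g (fderiv ℝ g x) x :=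
  hg.eventually_contDiffAt.self_of_nhds.hasStrictFDerivAt (by simp)

theorem hasFDerivAt (hg : IsSmoothSubmersionAt g x) : HasFDerivAt g (fderiv ℝ g x) x :=
  hg.hasStrictFDerivAt.hasFDerivAt

theorem comp {f : F → G} (hf : IsSmoothSubmersionAt f (g x)) (hg : IsSmoothSubmersionAt g x) :
    IsSmoothSubmersionAt (f ∘ g) x where
  eventually_contDiffAt := by
    filter_upwards [hg.eventually_contDiffAt,
      hg.hasFDerivAt.continuousAt.eventually hf.eventually_contDiffAt] with y hgy hfy
    exact hfy.comp y hgy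
  surjective_fderiv := by
    rw [(hf.hasFDerivAt.comp x hg.hasFDerivAt).fderiv]
    exact hf.surjective_fderiv.comp hg.surjective_fderiv

end IsSmoothSubmersionAt

theorem isSmoothSubmersionAt_continuousLinearMap {q : W →L[ℝ] F} (hq : Function.Surjective q)
    (y : W) : IsSmoothSubmersionAt q y where
  eventually_contDiffAt := Eventually.of_forall fun _ => q.contDiff.contDiffAt
  surjective_fderiv := by rwa [q.fderiv]

theorem IsSmoothSubmersionAt.snd {f : V → F × G} {x : V} (hf : IsSmoothSubmersionAt f x) :
    IsSmoothSubmersionAt (fun y => (f y).2) x :=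
  (isSmoothSubmersionAt_continuousLinearMap (q := ContinuousLinearMap.snd ℝ F G)
    Prod.snd_surjective _).comp hf

theorem exists_openPartialHomeomorph_of_hasFDerivAt_equiv [CompleteSpace V] {f : V → W}
    {A : V ≃L[ℝ] W} {x : V} {U : Set V} (hf : ∀ᶠ y in 𝓝 x, ContDiffAt ℝ ∞ f y)
    (hA : HasFDerivAt f (A : V →L[ℝ] W) x) (hU : U ∈ 𝓝 x) :
    ∃ Φ : OpenPartialHomeomorph V W, ⇑Φ = f ∧ x ∈ Φ.source ∧ Φ.source ⊆ U ∧
      ContDiffOn ℝ ∞ Φ Φ.source ∧ ContDiffOn ℝ ∞ Φ.symm Φ.target := by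
  have hfx : ContDiffAt ℝ ∞ f x := hf.self_of_nhds
  have hequiv : ∀ᶠ y in 𝓝 x, fderiv ℝ f y ∈ range ((↑) : (V ≃L[ℝ] W) → V →L[ℝ] W) := by
    have hcont : ContinuousAt (fderiv ℝ f) x :=
      (hfx.fderiv_right (m := 0) (by simp)).continuousAt
    exact hcont.eventually (hA.fderiv ▸ A.nhds)
  obtain ⟨O, hOP, hO, hxO⟩ := eventually_nhds_iff.1 ((hf.and hequiv).and hU)
  let Ψ := hfx.toOpenPartialHomeomorph f hA (by simp)
  have hxΨ : x ∈ Ψ.source := hfx.mem_toOpenPartialHomeomorph_source hA (by simp)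
  refine ⟨Ψ.restrOpen O hO, rfl, ⟨hxΨ, hxO⟩, fun y hy => (hOP y hy.2).2,
    fun y hy => (hOP y hy.2).1.1.contDiffWithinAt, fun z hz => ?_⟩
  obtain ⟨⟨hfz, B, hB⟩, -⟩ := hOP _ ((Ψ.restrOpen O hO).map_target hz).2
  refine ((Ψ.restrOpen O hO).contDiffAt_symm (f₀' := B) hz ?_ hfz).contDiffWithinAt
  rw [hB]
  exact (hfz.differentiableAt (by simp)).hasFDerivAt

theorem exists_continuousLinearEquiv_comp_eq [FiniteDimensional ℝ V] [FiniteDimensional ℝ W]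
    {f : V →L[ℝ] F} {q : W →L[ℝ] F} (hf : Function.Surjective f) (hq : Function.Surjective q)
    (hVW : finrank ℝ V = finrank ℝ W) : ∃ A : V ≃L[ℝ] W, ∀ v, q (A v) = f v := by
  have : FiniteDimensional ℝ F := Module.Finite.of_surjective f.toLinearMap hf
  obtain ⟨p, hp⟩ := f.ker_closedComplemented_of_finiteDimensional_range
  obtain ⟨s, hs⟩ := q.toLinearMap.exists_rightInverse_of_surjective (LinearMap.range_eq_top.2 hq)
  have hqs (w : F) : q (s w) = w := DFunLike.congr_fun hs w
  have hker : finrank ℝ f.ker = finrank ℝ q.ker := by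
    have hfV := f.toLinearMap.finrank_range_add_finrank_ker
    have hqW := q.toLinearMap.finrank_range_add_finrank_ker
    rw [LinearMap.range_eq_top.2 hf, finrank_top] at hfV
    rw [LinearMap.range_eq_top.2 hq, finrank_top] at hqW
    omega
  let e : f.ker ≃ₗ[ℝ] q.ker := LinearEquiv.ofFinrankEq _ _ hker
  let A : V →ₗ[ℝ] W :=
    q.ker.subtype ∘ₗ e.toLinearMap ∘ₗ p.toLinearMap + s ∘ₗ f.toLinearMap
  have hqA (v : V) : q (A v) = f v := by
    simp [A, hqs]
  have hA : Function.Injective A := by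
    refine (injective_iff_map_eq_zero A).2 fun v hv => ?_
    have hfv : f v = 0 := by rw [← hqA, hv, map_zero]
    have hpv : p v = 0 := by simpa [A, hfv] using hv
    simpa [hpv] using congrArg Subtype.val (hp ⟨v, hfv⟩).symm
  exact ⟨(LinearEquiv.ofInjectiveOfFinrankEq A hA hVW).toContinuousLinearEquiv, hqA⟩

namespace IsSmoothSubmersionAt

variable {g : V → F} {x : V}

theorem exists_chart [FiniteDimensional ℝ V] [FiniteDimensional ℝ W]
    (hg : IsSmoothSubmersionAt g x) {q : W →L[ℝ] F} (hq : Function.Surjective q)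
    (hVW : finrank ℝ V = finrank ℝ W) {U : Set V} (hU : U ∈ 𝓝 x) :
    ∃ Φ : OpenPartialHomeomorph V W, (∀ y, q (Φ y) = g y) ∧ x ∈ Φ.source ∧ Φ.source ⊆ U ∧
      ContDiffOn ℝ ∞ Φ Φ.source ∧ ContDiffOn ℝ ∞ Φ.symm Φ.target := by
  have : CompleteSpace V := FiniteDimensional.complete ℝ V
  have : FiniteDimensional ℝ F := Module.Finite.of_surjective q.toLinearMap hq
  obtain ⟨A, hA⟩ := exists_continuousLinearEquiv_comp_eq hg.surjective_fderiv hq hVW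
  obtain ⟨s, hs⟩ := q.toLinearMap.exists_rightInverse_of_surjective (LinearMap.range_eq_top.2 hq)
  have hqs (w : F) : q (s w) = w := DFunLike.congr_fun hs w
  -- The second summand vanishes to first order at `x` and corrects `q ∘ A = fderiv ℝ g x` to `g`.
  let Ψ (y : V) : W := A y + s.toContinuousLinearMap (g y - fderiv ℝ g x y)
  have hΨ : ∀ᶠ y in 𝓝 x, ContDiffAt ℝ ∞ Ψ y := by
    filter_upwards [hg.eventually_contDiffAt] with y hy
    fun_prop
  have hΨx : HasFDerivAt Ψ (A : V →L[ℝ] W) x := by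
    have h := A.hasFDerivAt.add (s.toContinuousLinearMap.hasFDerivAt.comp x
      (hg.hasFDerivAt.sub (fderiv ℝ g x).hasFDerivAt))
    rwa [sub_self, ContinuousLinearMap.comp_zero, add_zero] at h
  obtain ⟨Φ, hΦ, hΦ'⟩ := exists_openPartialHomeomorph_of_hasFDerivAt_equiv hΨ hΨx hU
  refine ⟨Φ, fun y => ?_, hΦ'⟩
  simp [hΦ, Ψ, hA, hqs]

theorem exists_hasDerivAt_eventually_eq [CompleteSpace V] [FiniteDimensional ℝ F]
    (hg : IsSmoothSubmersionAt g x) {v : V} (hv : fderiv ℝ g x v = 0) :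
    ∃ γ : ℝ → V, HasDerivAt γ v 0 ∧ γ 0 = x ∧ ∀ᶠ t in 𝓝 0, g (γ t) = g x := by
  have hrange : (fderiv ℝ g x).range = ⊤ := LinearMap.range_eq_top.2 hg.surjective_fderiv
  let w : (fderiv ℝ g x).ker := ⟨v, hv⟩
  let φ := hg.hasStrictFDerivAt.implicitFunction g (fderiv ℝ g x) hrange (g x)
  refine ⟨fun t => φ (t • w), ?_, by simp [φ], ?_⟩
  · have hφ : HasFDerivAt φ (fderiv ℝ g x).ker.subtypeL ((0 : ℝ) • w) := by
      simpa using (hg.hasStrictFDerivAt.to_implicitFunction hrange).hasFDerivAt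
    have hline : HasDerivAt (fun t : ℝ => t • w) w 0 := by
      simpa using (hasDerivAt_id (0 : ℝ)).smul_const w
    exact hφ.comp_hasDerivAt 0 hline
  · have hline : Tendsto (fun t : ℝ => (g x, t • w)) (𝓝 0) (𝓝 (g x, 0)) :=
      Continuous.tendsto' (by fun_prop) _ _ (by simp)
    exact hline.eventually (hg.hasStrictFDerivAt.map_implicitFunction_eq hrange)

end IsSmoothSubmersionAt

end Submersions

section LocalEquations

variable {V W F G : Type*} [NormedAddCommGroup V] [NormedSpace ℝ V]
  [NormedAddCommGroup W] [NormedSpace ℝ W] [NormedAddCommGroup F] [NormedSpace ℝ F]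
  [NormedAddCommGroup G] [NormedSpace ℝ G] {N M B : Set V} {x v : V} {d : ℕ}

/-- Near its point `x`, the set `N` is the zero set of the submersion `g`. -/
structure IsLocalEquationAt (g : V → F) (N : Set V) (x : V) : Prop
    extends IsSmoothSubmersionAt g x where
  apply_eq_zero : g x = 0
  eventually_mem_iff : ∀ᶠ y in 𝓝 x, y ∈ N ↔ g y = 0

/-- Near its point `x`, the set `N` is the part `0 ≤ ρ` of the zero set of `g`, where `(ρ, g)` is a
submersion that vanishes at `x`. This is how a submanifold looks near a boundary point. -/
structure IsLocalBoundaryEquationAt (ρ : V → ℝ) (g : V → F) (N : Set V) (x : V) : Prop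
    extends IsSmoothSubmersionAt (fun y => (ρ y, g y)) x where
  boundary_apply_eq_zero : ρ x = 0
  apply_eq_zero : g x = 0
  eventually_mem_iff : ∀ᶠ y in 𝓝 x, y ∈ N ↔ 0 ≤ ρ y ∧ g y = 0

theorem bijective_fderiv_openPartialHomeomorph {Φ : OpenPartialHomeomorph V F}
    (hΦ : DifferentiableOn ℝ Φ Φ.source) (hΦs : DifferentiableOn ℝ Φ.symm Φ.target)
    (hx : x ∈ Φ.source) : Function.Bijective (fderiv ℝ Φ x) := by
  have hΦ' : Φ.MDifferentiable (modelWithCornersSelf ℝ V) (modelWithCornersSelf ℝ F) :=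
    ⟨hΦ.mdifferentiableOn, hΦs.mdifferentiableOn⟩
  exact mfderiv_eq_fderiv (𝕜 := ℝ) (f := Φ) ▸ hΦ'.mfderiv_bijective hx

theorem isSmoothSubmersionAt_openPartialHomeomorph {Φ : OpenPartialHomeomorph V F}
    (hΦ : ContDiffOn ℝ ∞ Φ Φ.source) (hΦs : ContDiffOn ℝ ∞ Φ.symm Φ.target)
    (hx : x ∈ Φ.source) : IsSmoothSubmersionAt Φ x where
  eventually_contDiffAt := by
    filter_upwards [Φ.open_source.mem_nhds hx] with y hy
    exact hΦ.contDiffAt (Φ.open_source.mem_nhds hy)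
  surjective_fderiv := (bijective_fderiv_openPartialHomeomorph (hΦ.differentiableOn (by simp))
    (hΦs.differentiableOn (by simp)) hx).surjective

namespace IsLocalEquationAt

variable {g : V → F}

theorem mem (hg : IsLocalEquationAt g N x) : x ∈ N :=
  hg.eventually_mem_iff.self_of_nhds.2 hg.apply_eq_zero

theorem comp {g : W → F} {f : V → W} {M : Set W} (hg : IsLocalEquationAt g M (f x))
    (hf : IsSmoothSubmersionAt f x) (hN : ∀ᶠ y in 𝓝 x, y ∈ N ↔ f y ∈ M) :
    IsLocalEquationAt (g ∘ f) N x where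
  toIsSmoothSubmersionAt := hg.toIsSmoothSubmersionAt.comp hf
  apply_eq_zero := hg.apply_eq_zero
  eventually_mem_iff := by
    filter_upwards [hN, hf.hasFDerivAt.continuousAt.eventually hg.eventually_mem_iff]
      with y hyN hyM using hyN.trans hyM

theorem isInteriorPoint [FiniteDimensional ℝ V] [FiniteDimensional ℝ F]
    (hg : IsLocalEquationAt g N x) (hd : finrank ℝ V = d + finrank ℝ F) :
    IsInteriorPoint N d x := by
  let e : EuclideanSpace ℝ (Fin (finrank ℝ F)) ≃L[ℝ] F :=
    ContinuousLinearEquiv.ofFinrankEq (by simp)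
  obtain ⟨Φ, hΦg, hxΦ, hΦN, hΦ, hΦs⟩ := hg.exists_chart
    (W := EuclideanSpace ℝ (Fin d) × EuclideanSpace ℝ (Fin (finrank ℝ F)))
    (q := e.toContinuousLinearMap ∘L ContinuousLinearMap.snd ℝ _ _)
    (e.surjective.comp Prod.snd_surjective)
    (by simpa using hd) hg.eventually_mem_iff
  refine ⟨hg.mem, finrank ℝ F, Φ, hxΦ, hΦ, hΦs, ?_⟩
  ext y
  refine and_comm.trans (and_congr_right fun hy => (hΦN hy).trans ?_)
  rw [← hΦg]
  exact map_eq_zero_iff e e.injective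

theorem exists_hasDerivAt_eventually_mem [CompleteSpace V] [FiniteDimensional ℝ F]
    (hg : IsLocalEquationAt g N x) (hv : fderiv ℝ g x v = 0) :
    ∃ γ : ℝ → V, HasDerivAt γ v 0 ∧ γ 0 = x ∧ ∀ᶠ t in 𝓝 0, γ t ∈ N := by
  obtain ⟨γ, hγ, hγ0, hgγ⟩ := hg.toIsSmoothSubmersionAt.exists_hasDerivAt_eventually_eq hv
  refine ⟨γ, hγ, hγ0, ?_⟩
  have hγx : Tendsto γ (𝓝 0) (𝓝 x) := hγ0 ▸ hγ.continuousAt.tendsto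
  filter_upwards [hγx.eventually hg.eventually_mem_iff, hgγ] with t htN htg
  exact htN.2 (htg.trans hg.apply_eq_zero)

end IsLocalEquationAt

theorem IsInteriorPoint.exists_isLocalEquationAt (h : IsInteriorPoint N d x) :
    ∃ (c : ℕ) (g : V → EuclideanSpace ℝ (Fin c)),
      IsLocalEquationAt g N x ∧ finrank ℝ V = d + c := by
  obtain ⟨hxN, c, Φ, hx, hΦ, hΦs, hN⟩ := h
  have hNΦ : ∀ y ∈ Φ.source, y ∈ N ↔ (Φ y).2 = 0 := fun y hy => by
    simpa [hy] using Set.ext_iff.1 hN y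
  refine ⟨c, fun y => (Φ y).2, ⟨?_, (hNΦ x hx).1 hxN, ?_⟩, ?_⟩
  · exact (isSmoothSubmersionAt_openPartialHomeomorph hΦ hΦs hx).snd
  · filter_upwards [Φ.open_source.mem_nhds hx] with y hy using hNΦ y hy
  · have hfin := (LinearEquiv.ofBijective (fderiv ℝ Φ x).toLinearMap
      (bijective_fderiv_openPartialHomeomorph (hΦ.differentiableOn (by simp))
        (hΦs.differentiableOn (by simp)) hx)).finrank_eq
    simpa using hfin

theorem IsBoundaryPoint.exists_isLocalBoundaryEquationAt (h : IsBoundaryPoint N d x) :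
    ∃ (c : ℕ) (ρ : V → ℝ) (g : V → EuclideanSpace ℝ (Fin c)),
      IsLocalBoundaryEquationAt ρ g N x := by
  obtain ⟨hxN, k, c, Φ, -, hx, hΦ, hΦs, hN, hρ⟩ := h
  have hNΦ : ∀ y ∈ Φ.source, y ∈ N ↔ 0 ≤ (Φ y).1.1 ∧ (Φ y).2 = 0 := fun y hy => by
    simpa [hy] using Set.ext_iff.1 hN y
  refine ⟨c, fun y => (Φ y).1.1, fun y => (Φ y).2, ⟨?_, hρ, ((hNΦ x hx).1 hxN).2, ?_⟩⟩
  · exact (isSmoothSubmersionAt_continuousLinearMap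
      (q := (ContinuousLinearMap.fst ℝ ℝ _).prodMap (ContinuousLinearMap.id ℝ _))
      (Prod.fst_surjective.prodMap Function.surjective_id) _).comp
      (isSmoothSubmersionAt_openPartialHomeomorph hΦ hΦs hx)
  · filter_upwards [Φ.open_source.mem_nhds hx] with y hy using hNΦ y hy

theorem hasDerivAt_mem_tangentConeAt {γ : ℝ → V} (hγ : HasDerivAt γ v 0)
    (hγN : ∀ᶠ t in 𝓝[>] 0, γ t ∈ N) : v ∈ tangentConeAt ℝ N (γ 0) := by
  refine mem_tangentConeAt_of_seq (𝓝[>] (0 : ℝ)) (fun t => t⁻¹) (fun t => γ t - γ 0) ?_ ?_ ?_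
  · simpa using (hγ.continuousAt.tendsto.mono_left (nhdsWithin_le_nhds (s := Ioi 0))).sub_const
      (γ 0)
  · simpa using hγN
  · simpa using hγ.tendsto_slope_zero_right

theorem tangentSubspace_mono (h : N ⊆ M) (x : V) : tangentSubspace N x ≤ tangentSubspace M x :=
  Submodule.span_mono (tangentConeAt_mono h)

theorem tangentSubspace_le_ker {g : V → F} {g' : V →L[ℝ] F} (hg : HasFDerivAt g g' x)
    (hgN : ∀ᶠ y in 𝓝 x, y ∈ N → g y = 0) (hgx : g x = 0) : tangentSubspace N x ≤ g'.ker := by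
  refine Submodule.span_le.2 fun v hv => ?_
  rw [← tangentConeAt_inter_nhds hgN] at hv
  have himage : g '' (N ∩ {y | y ∈ N → g y = 0}) ⊆ {g x} := by
    rintro _ ⟨y, hy, rfl⟩
    exact (hy.2 hy.1).trans hgx.symm
  have hg'v := tangentConeAt_mono himage (hg.hasFDerivWithinAt.mapsTo_tangent_cone hv)
  have hacc : ¬ AccPt (g x) (𝓟 {g x}) := fun h => by
    obtain ⟨y, hy, hne⟩ := accPt_iff_nhds.1 h univ univ_mem
    exact hne hy.2
  exact tangentConeAt_subset_zero hacc hg'v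

theorem IsLocalEquationAt.tangentSubspace_eq [CompleteSpace V] [FiniteDimensional ℝ F] {g : V → F}
    (hg : IsLocalEquationAt g N x) : tangentSubspace N x = (fderiv ℝ g x).ker := by
  refine le_antisymm (tangentSubspace_le_ker hg.hasFDerivAt
    (hg.eventually_mem_iff.mono fun y hy => hy.1) hg.apply_eq_zero) fun v hv => ?_
  obtain ⟨γ, hγ, rfl, hγN⟩ := hg.exists_hasDerivAt_eventually_mem hv
  exact Submodule.subset_span
    (hasDerivAt_mem_tangentConeAt hγ (hγN.filter_mono nhdsWithin_le_nhds))

namespace IsLocalBoundaryEquationAt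

variable {ρ : V → ℝ} {g : V → F}

theorem mem (h : IsLocalBoundaryEquationAt ρ g N x) : x ∈ N :=
  h.eventually_mem_iff.self_of_nhds.2 ⟨h.boundary_apply_eq_zero.ge, h.apply_eq_zero⟩

theorem hasFDerivAt_boundary (h : IsLocalBoundaryEquationAt ρ g N x) :
    HasFDerivAt ρ (fderiv ℝ ρ x) x :=
  h.hasFDerivAt.fst.differentiableAt.hasFDerivAt

theorem isSmoothSubmersionAt_snd (h : IsLocalBoundaryEquationAt ρ g N x) :
    IsSmoothSubmersionAt g x :=
  h.toIsSmoothSubmersionAt.snd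

theorem fderiv_eq_prod (h : IsLocalBoundaryEquationAt ρ g N x) :
    fderiv ℝ (fun y => (ρ y, g y)) x = (fderiv ℝ ρ x).prod (fderiv ℝ g x) :=
  (h.hasFDerivAt_boundary.prodMk h.isSmoothSubmersionAt_snd.hasFDerivAt).fderiv

theorem exists_inward (h : IsLocalBoundaryEquationAt ρ g N x) :
    ∃ v, fderiv ℝ ρ x v = 1 ∧ fderiv ℝ g x v = 0 := by
  obtain ⟨v, hv⟩ := h.surjective_fderiv (1, 0)
  rw [h.fderiv_eq_prod] at hv
  exact ⟨v, congrArg Prod.fst hv, congrArg Prod.snd hv⟩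

theorem isBoundaryPoint [FiniteDimensional ℝ V] [FiniteDimensional ℝ F]
    (h : IsLocalBoundaryEquationAt ρ g N x) (hd : finrank ℝ V = d + finrank ℝ F) :
    IsBoundaryPoint N d x := by
  obtain ⟨k, rfl⟩ : ∃ k, d = k + 1 := by
    have hle := LinearMap.finrank_le_finrank_of_surjective
      (f := (fderiv ℝ (fun y => (ρ y, g y)) x).toLinearMap) h.surjective_fderiv
    rw [finrank_prod, finrank_self] at hle
    exact Nat.exists_eq_add_one.2 (by omega)
  let e : EuclideanSpace ℝ (Fin (finrank ℝ F)) ≃L[ℝ] F :=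
    ContinuousLinearEquiv.ofFinrankEq (by simp)
  obtain ⟨Φ, hΦg, hxΦ, hΦN, hΦ, hΦs⟩ := h.exists_chart
    (W := (ℝ × EuclideanSpace ℝ (Fin k)) × EuclideanSpace ℝ (Fin (finrank ℝ F)))
    (q := (ContinuousLinearMap.fst ℝ ℝ _).prodMap e.toContinuousLinearMap)
    (Prod.fst_surjective.prodMap e.surjective) (by simp [hd, add_comm]) h.eventually_mem_iff
  have hΦρ (y : V) : (Φ y).1.1 = ρ y := congrArg Prod.fst (hΦg y)
  refine ⟨h.mem, k, finrank ℝ F, Φ, rfl, hxΦ, hΦ, hΦs, ?_,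
    (hΦρ x).trans h.boundary_apply_eq_zero⟩
  ext y
  refine and_comm.trans (and_congr_right fun hy => (hΦN hy).trans ?_)
  rw [hΦρ, ← map_eq_zero_iff e e.injective, ← show e (Φ y).2 = g y from congrArg Prod.snd (hΦg y)]

theorem mem_tangentConeAt [CompleteSpace V] [FiniteDimensional ℝ F]
    (h : IsLocalBoundaryEquationAt ρ g N x) (hg : fderiv ℝ g x v = 0) (hρ : 0 < fderiv ℝ ρ x v) :
    v ∈ tangentConeAt ℝ (N ∩ {y | 0 < ρ y}) x := by
  obtain ⟨γ, hγ, rfl, hgγ⟩ := h.isSmoothSubmersionAt_snd.exists_hasDerivAt_eventually_eq hg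
  refine hasDerivAt_mem_tangentConeAt hγ ?_
  have hργ : ∀ᶠ t in 𝓝[>] (0 : ℝ), 0 < t⁻¹ • (ρ (γ (0 + t)) - ρ (γ 0)) :=
    (h.hasFDerivAt_boundary.comp_hasDerivAt (0 : ℝ) hγ).tendsto_slope_zero_right.eventually
      (lt_mem_nhds hρ)
  filter_upwards [hργ, self_mem_nhdsWithin,
    nhdsWithin_le_nhds (hγ.continuousAt.eventually h.eventually_mem_iff),
    nhdsWithin_le_nhds hgγ] with t htρ (ht : 0 < t) htN htg
  rw [zero_add, h.boundary_apply_eq_zero, sub_zero, smul_eq_mul,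
    mul_pos_iff_of_pos_left (inv_pos.2 ht)] at htρ
  exact ⟨htN.2 ⟨htρ.le, htg.trans h.apply_eq_zero⟩, htρ⟩

theorem mem_closure [CompleteSpace V] [FiniteDimensional ℝ F]
    (h : IsLocalBoundaryEquationAt ρ g N x) : x ∈ closure (N ∩ {y | 0 < ρ y}) := by
  obtain ⟨v, hρv, hgv⟩ := h.exists_inward
  exact mem_closure_of_nonempty_tangentConeAt ⟨v, h.mem_tangentConeAt hgv (hρv ▸ one_pos)⟩

theorem tangentSubspace_eq [CompleteSpace V] [FiniteDimensional ℝ F]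
    (h : IsLocalBoundaryEquationAt ρ g N x) : tangentSubspace N x = (fderiv ℝ g x).ker := by
  refine le_antisymm (tangentSubspace_le_ker h.isSmoothSubmersionAt_snd.hasFDerivAt
    (h.eventually_mem_iff.mono fun y hy hyN => (hy.1 hyN).2) h.apply_eq_zero) fun w hw => ?_
  have hpos {u : V} (hu : fderiv ℝ g x u = 0) (hρu : 0 < fderiv ℝ ρ x u) :
      u ∈ tangentSubspace N x :=
    Submodule.subset_span (tangentConeAt_mono inter_subset_left (h.mem_tangentConeAt hu hρu))
  -- Adding a large multiple of an inward vector makes any vector of the kernel point inwards.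
  obtain ⟨v, hρv, hgv⟩ := h.exists_inward
  let a : ℝ := |fderiv ℝ ρ x w| + 1
  have hwv : w + a • v ∈ tangentSubspace N x := by
    refine hpos ?_ ?_
    · simp [hgv, show fderiv ℝ g x w = 0 from hw]
    · simp only [map_add, map_smul, hρv, smul_eq_mul, mul_one, a]
      linarith [neg_abs_le (fderiv ℝ ρ x w)]
  simpa using sub_mem hwv (Submodule.smul_mem _ a (hpos hgv (hρv ▸ one_pos)))

end IsLocalBoundaryEquationAt

/-- A curve in `N` whose velocity points inwards at a boundary point would have to leave `N` in
negative time. -/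
theorem IsLocalEquationAt.not_isLocalBoundaryEquationAt [CompleteSpace V] [FiniteDimensional ℝ F]
    [FiniteDimensional ℝ G] {f : V → F} {ρ : V → ℝ} {g : V → G} (hf : IsLocalEquationAt f N x) :
    ¬ IsLocalBoundaryEquationAt ρ g N x := by
  intro hg
  obtain ⟨v, hρv, hgv⟩ := hg.exists_inward
  have hfv : v ∈ (fderiv ℝ f x).ker := by
    rw [← hf.tangentSubspace_eq, hg.tangentSubspace_eq]
    exact hgv
  obtain ⟨γ, hγ, rfl, hγN⟩ := hf.exists_hasDerivAt_eventually_mem hfv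
  have hmin : IsLocalMin (ρ ∘ γ) 0 := by
    filter_upwards [hγN, hγ.continuousAt.eventually hg.eventually_mem_iff] with t htN ht
    rw [Function.comp_apply, hg.boundary_apply_eq_zero]
    exact (ht.1 htN).1
  have hρv' : fderiv ℝ ρ (γ 0) v = 0 :=
    hmin.hasDerivAt_eq_zero (hg.hasFDerivAt_boundary.comp_hasDerivAt (0 : ℝ) hγ)
  exact one_ne_zero (hρv.symm.trans hρv')

theorem IsLocalEquationAt.not_isBoundaryPoint [CompleteSpace V] [FiniteDimensional ℝ F] {g : V → F}
    (hg : IsLocalEquationAt g N x) : ¬ IsBoundaryPoint N d x := fun h =>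
  have ⟨_, _, _, hN⟩ := h.exists_isLocalBoundaryEquationAt
  hg.not_isLocalBoundaryEquationAt hN

theorem IsLocalBoundaryEquationAt.tangentSubspace_sup_eq [CompleteSpace V] [FiniteDimensional ℝ F]
    [FiniteDimensional ℝ G] {ρ : V → ℝ} {f : V → F} {g : V → G}
    (hN : IsLocalBoundaryEquationAt ρ f N x) (hM : IsLocalBoundaryEquationAt ρ g M x)
    (hB : IsLocalEquationAt (fun y => (ρ y, g y)) B x) (hNM : N ⊆ M) :
    tangentSubspace N x ⊔ tangentSubspace B x = tangentSubspace M x := by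
  have hTB : tangentSubspace B x = ((fderiv ℝ ρ x).prod (fderiv ℝ g x)).ker := by
    rw [hB.tangentSubspace_eq, hM.fderiv_eq_prod]
  have hTN := tangentSubspace_mono hNM x
  refine le_antisymm (sup_le hTN ?_) fun w hw => ?_
  · rw [hTB, hM.tangentSubspace_eq]
    exact fun w hw => congrArg Prod.snd hw
  · obtain ⟨v, hρv, hfv⟩ := hN.exists_inward
    have hvN : v ∈ tangentSubspace N x := hN.tangentSubspace_eq ▸ hfv
    have hgM {u : V} (hu : u ∈ tangentSubspace M x) : fderiv ℝ g x u = 0 := by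
      rwa [hM.tangentSubspace_eq] at hu
    rw [← add_sub_cancel (fderiv ℝ ρ x w • v) w, hTB]
    exact Submodule.add_mem_sup (Submodule.smul_mem _ _ hvN)
      (Prod.ext (by simp [hρv]) (by simp [hgM hw, hgM (hTN hvN)]))

end LocalEquations

section UnitSphere

variable {E F : Type*} [NormedAddCommGroup E] [NormedAddCommGroup F] [NormedSpace ℝ F]
  {p : ℝ × E}

/-- A defining function of the cylinder `ℝ × S` over the unit sphere `S` of `E`. -/
def cylinderFun (p : ℝ × E) : ℝ := ‖p.2‖ ^ 2 - 1

theorem cylinderFun_eq_zero_iff : cylinderFun p = 0 ↔ ‖p.2‖ = 1 := by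
  rw [cylinderFun, sub_eq_zero, pow_eq_one_iff_of_nonneg (norm_nonneg _) two_ne_zero]

theorem mem_chartAtInfinity_iff : p ∈ chartAtInfinity E ↔ 0 ≤ p.1 ∧ ‖p.2‖ = 1 := by
  simp [chartAtInfinity]

theorem mem_sphereAtInfinity_iff : p ∈ sphereAtInfinity E ↔ p.1 = 0 ∧ ‖p.2‖ = 1 := by
  simp [sphereAtInfinity]

theorem isClosed_chartAtInfinity : IsClosed (chartAtInfinity E) :=
  isClosed_Ici.prod Metric.isClosed_sphere

theorem asymptoticSet_nonempty [NormedSpace ℝ E] [ProperSpace E] {X : Set E}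
    (hX : ¬ Bornology.IsBounded X) : (asymptoticSet X).Nonempty := by
  have : (Bornology.cobounded E ⊓ 𝓟 X).NeBot := by
    rwa [neBot_iff, Ne, ← disjoint_iff, disjoint_principal_right, ← Bornology.isBounded_def]
  let U := Ultrafilter.of (Bornology.cobounded E ⊓ 𝓟 X)
  have hUX : ∀ᶠ x in U, x ∈ X :=
    (Ultrafilter.of_le _).trans inf_le_right (mem_principal_self X)
  have hUcob : (U : Filter E) ≤ Bornology.cobounded E := (Ultrafilter.of_le _).trans inf_le_left
  have hUpos : ∀ᶠ x : E in U, 0 < ‖x‖ :=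
    (tendsto_norm_cobounded_atTop.mono_left hUcob).eventually_gt_atTop 0
  have hUsphere : ∀ᶠ x in U, ‖x‖⁻¹ • x ∈ Metric.sphere (0 : E) 1 := by
    filter_upwards [hUpos] with x hx
    simp [norm_smul, hx.ne']
  obtain ⟨u, hu, hUu⟩ :=
    (isCompact_sphere (0 : E) 1).ultrafilter_le_nhds' (U.map fun x => ‖x‖⁻¹ • x) hUsphere
  have hUinv : Tendsto (fun x : E => ‖x‖⁻¹) U (𝓝 0) :=
    tendsto_inv_atTop_zero.comp (tendsto_norm_cobounded_atTop.mono_left hUcob)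
  refine ⟨(0, u), mem_closure_of_tendsto (hUinv.prodMk_nhds hUu) ?_, rfl, hu⟩
  filter_upwards [hUX, hUpos, hUsphere] with x hxX hx hxu
  refine ⟨inv_pos.2 hx, mem_sphere_zero_iff_norm.1 hxu, ?_⟩
  rwa [inv_inv, smul_inv_smul₀ hx.ne']

variable [InnerProductSpace ℝ E]

theorem contDiff_cylinderFun : ContDiff ℝ ∞ (cylinderFun : ℝ × E → ℝ) :=
  ((contDiff_norm_sq ℝ).comp contDiff_snd).sub contDiff_const

theorem fderiv_cylinderFun_self : fderiv ℝ cylinderFun p p = 2 * ‖p.2‖ ^ 2 := by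
  have hcyl : HasFDerivAt cylinderFun (fderiv ℝ cylinderFun p) p :=
    (contDiff_cylinderFun.differentiable (by simp) p).hasFDerivAt
  have hray : HasDerivAt (fun t : ℝ => t • p) p 1 := by
    simpa using (hasDerivAt_id (1 : ℝ)).smul_const p
  have hsq : HasDerivAt (fun t : ℝ => cylinderFun (t • p)) (2 * ‖p.2‖ ^ 2) 1 := by
    have h := (((hasDerivAt_id (1 : ℝ)).pow 2).mul_const (‖p.2‖ ^ 2)).sub_const 1
    simpa [cylinderFun, norm_smul, mul_pow] using h
  exact (hcyl.comp_hasDerivAt_of_eq 1 hray (one_smul ℝ p).symm).unique hsq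

theorem isSmoothSubmersionAt_cylinderFun_prodMk {g : ℝ × E → F} (hg : IsSmoothSubmersionAt g p)
    (hp : ‖p.2‖ = 1) (hgp : fderiv ℝ g p p = 0) :
    IsSmoothSubmersionAt (fun q => (cylinderFun q, g q)) p where
  eventually_contDiffAt := by
    filter_upwards [hg.eventually_contDiffAt] with q hq
    exact contDiff_cylinderFun.contDiffAt.prodMk hq
  surjective_fderiv := by
    have hcyl := contDiff_cylinderFun.differentiable (by simp) p
    have hcylp : fderiv ℝ cylinderFun p p = 2 := by simp [fderiv_cylinderFun_self, hp]
    rw [(hcyl.hasFDerivAt.prodMk hg.hasFDerivAt).fderiv]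
    rintro ⟨a, b⟩
    obtain ⟨v, rfl⟩ := hg.surjective_fderiv b
    refine ⟨v + ((a - fderiv ℝ cylinderFun p v) / 2) • p, Prod.ext ?_ (by simp [hgp])⟩
    simp [hcylp]

theorem isSmoothSubmersionAt_fst_cylinderFun (hp : p ∈ sphereAtInfinity E) :
    IsSmoothSubmersionAt (fun q : ℝ × E => (q.1, cylinderFun q)) p := by
  obtain ⟨hp1, hp2⟩ := mem_sphereAtInfinity_iff.1 hp
  have hfst : IsSmoothSubmersionAt (Prod.fst : ℝ × E → ℝ) p :=
    isSmoothSubmersionAt_continuousLinearMap (q := ContinuousLinearMap.fst ℝ ℝ E)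
      Prod.fst_surjective p
  have hcyl := isSmoothSubmersionAt_cylinderFun_prodMk hfst hp2 (by rw [fderiv_fst]; exact hp1)
  exact (isSmoothSubmersionAt_continuousLinearMap
    (q := (ContinuousLinearEquiv.prodComm ℝ ℝ ℝ).toContinuousLinearMap)
    (ContinuousLinearEquiv.prodComm ℝ ℝ ℝ).surjective _).comp hcyl

theorem isLocalBoundaryEquationAt_chartAtInfinity (hp : p ∈ sphereAtInfinity E) :
    IsLocalBoundaryEquationAt Prod.fst cylinderFun (chartAtInfinity E) p where
  toIsSmoothSubmersionAt := isSmoothSubmersionAt_fst_cylinderFun hp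
  boundary_apply_eq_zero := (mem_sphereAtInfinity_iff.1 hp).1
  apply_eq_zero := cylinderFun_eq_zero_iff.2 (mem_sphereAtInfinity_iff.1 hp).2
  eventually_mem_iff := Eventually.of_forall fun q => by
    rw [mem_chartAtInfinity_iff, cylinderFun_eq_zero_iff]

theorem isLocalEquationAt_sphereAtInfinity (hp : p ∈ sphereAtInfinity E) :
    IsLocalEquationAt (fun q => (q.1, cylinderFun q)) (sphereAtInfinity E) p where
  toIsSmoothSubmersionAt := isSmoothSubmersionAt_fst_cylinderFun hp
  apply_eq_zero := by
    simpa [mem_sphereAtInfinity_iff, cylinderFun_eq_zero_iff] using hp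
  eventually_mem_iff := Eventually.of_forall fun q => by
    simp [mem_sphereAtInfinity_iff, cylinderFun_eq_zero_iff]

end UnitSphere

section ProjectiveCone

section

variable {K V : Type*} [DivisionRing K] [AddCommGroup V] [Module K V] {X : Set (ℙ K V)}

/-- The cone over a set of points of a projective space, without its apex `0`. -/
def projectiveCone (X : Set (ℙ K V)) : Set V :=
  {v | ∃ h : v ≠ 0, Projectivization.mk K v h ∈ X}

theorem smul_mem_projectiveCone {a : K} {v : V} (ha : a ≠ 0) (hv : v ∈ projectiveCone X) :
    a • v ∈ projectiveCone X := by
  obtain ⟨h, hX⟩ := hv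
  refine ⟨smul_ne_zero ha h, ?_⟩
  rwa [(Projectivization.mk_eq_mk_iff' K _ _ _ h).2 ⟨a, rfl⟩]

theorem isClosed_insert_zero_projectiveCone [TopologicalSpace V] [T1Space V] (hX : IsClosed X) :
    IsClosed (insert 0 (projectiveCone X)) := by
  have hopen : IsOpen (Subtype.val '' (Projectivization.mk' K ⁻¹' Xᶜ : Set {v : V // v ≠ 0})) :=
    isOpen_ne.isOpenMap_subtype_val _ (hX.isOpen_compl.preimage continuous_coinduced_rng)
  convert hopen.isClosed_compl using 1
  ext v
  by_cases hv : v = 0 <;> simp [projectiveCone, hv]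

end

variable {𝕂 : Type*} [RCLike 𝕂] {n : ℕ} {X : Set (ℙ 𝕂 (Fin (n + 1) → 𝕂))}
  {v : Fin (n + 1) → 𝕂} {i : Fin (n + 1)}

theorem smul_self_mem_tangentSubspace_projectiveCone (hv : v ∈ projectiveCone X) (a : 𝕂) :
    a • v ∈ tangentSubspace (projectiveCone X) v := by
  have hγ : HasDerivAt (fun t : ℝ => v + t • a • v) (a • v) 0 := by
    simpa using ((hasDerivAt_id (0 : ℝ)).smul_const (a • v)).const_add v
  have hne : ∀ᶠ t : ℝ in 𝓝 0, 1 + (t : 𝕂) * a ≠ 0 :=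
    ContinuousAt.eventually_ne (by fun_prop) (by simp)
  have hγX : ∀ᶠ t : ℝ in 𝓝[>] 0, v + t • a • v ∈ projectiveCone X := by
    filter_upwards [nhdsWithin_le_nhds hne] with t ht
    convert smul_mem_projectiveCone ht hv using 1
    rw [add_smul, one_smul, mul_smul, RCLike.real_smul_eq_coe_smul (K := 𝕂)]
  simpa [tangentSubspace] using Submodule.subset_span (hasDerivAt_mem_tangentConeAt hγ hγX)

/-- The coordinates in the `i`-th standard affine chart of the point with homogeneous coordinates
`v`, provided that `v i ≠ 0`. -/
def affineChart (i : Fin (n + 1)) (v : Fin (n + 1) → 𝕂) : EuclideanSpace 𝕂 (Fin n) :=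
  WithLp.toLp 2 fun j => v (i.succAbove j) / v i

theorem affineEmbedding_affineChart (hv : v ≠ 0) (hi : v i ≠ 0) :
    affineEmbedding i (affineChart i v) = Projectivization.mk 𝕂 v hv := by
  refine (Projectivization.mk_eq_mk_iff' ..).2 ⟨(v i)⁻¹, ?_⟩
  ext j
  cases j using i.succAboveCases <;> simp [affineChart, hi, div_eq_inv_mul]

theorem mem_projectiveCone_iff (hi : v i ≠ 0) :
    v ∈ projectiveCone X ↔ affineChart i v ∈ affineEmbedding i ⁻¹' X := by
  have hv : v ≠ 0 := fun h => hi (congrFun h i)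
  rw [mem_preimage, affineEmbedding_affineChart hv hi]
  exact ⟨fun h => h.2, fun h => ⟨hv, h⟩⟩

theorem mk_mem_hyperplaneAtInfinity_iff (hv : v ≠ 0) :
    Projectivization.mk 𝕂 v hv ∈ hyperplaneAtInfinity 𝕂 n ↔ v (Fin.last n) = 0 := by
  rw [hyperplaneAtInfinity, mem_compl_iff, not_iff_comm]
  refine ⟨fun h => ⟨_, affineEmbedding_affineChart hv h⟩, fun ⟨x, hx⟩ h => ?_⟩
  obtain ⟨a, ha⟩ := (Projectivization.mk_eq_mk_iff' ..).1 hx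
  simpa [h] using congrFun ha (Fin.last n)

theorem affineEmbedding_mem_hyperplaneAtInfinity_iff {k : Fin n} (hk : i.succAbove k = Fin.last n)
    {x : EuclideanSpace 𝕂 (Fin n)} :
    affineEmbedding i x ∈ hyperplaneAtInfinity 𝕂 n ↔ x k = 0 := by
  rw [affineEmbedding, mk_mem_hyperplaneAtInfinity_iff, ← hk, Fin.insertNth_apply_succAbove]

theorem apply_eq_zero_of_mem_tangentSubspace_hyperplaneAtInfinity {k : Fin n}
    (hk : i.succAbove k = Fin.last n) {x y : EuclideanSpace 𝕂 (Fin n)}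
    (hx : affineEmbedding i x ∈ hyperplaneAtInfinity 𝕂 n)
    (hy : y ∈ tangentSubspace (affineEmbedding i ⁻¹' hyperplaneAtInfinity 𝕂 n) x) : y k = 0 := by
  let coord : EuclideanSpace 𝕂 (Fin n) →L[ℝ] 𝕂 :=
    (EuclideanSpace.proj k : EuclideanSpace 𝕂 (Fin n) →L[𝕂] 𝕂).restrictScalars ℝ
  exact tangentSubspace_le_ker (coord.hasFDerivAt (x := x))
    (Eventually.of_forall fun z => (affineEmbedding_mem_hyperplaneAtInfinity_iff hk).1)
    ((affineEmbedding_mem_hyperplaneAtInfinity_iff hk).1 hx) hy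

theorem contDiffAt_affineChart (hi : v i ≠ 0) : ContDiffAt ℝ ∞ (affineChart i) v := by
  refine contDiffAt_piLp' 2 fun j => ?_
  simp only [affineChart, div_eq_mul_inv]
  exact (contDiff_apply ℝ 𝕂 _).contDiffAt.mul ((contDiff_apply ℝ 𝕂 i).contDiffAt.inv hi)

theorem fderiv_affineChart_insertNth (hi : v i ≠ 0) (y : EuclideanSpace 𝕂 (Fin n)) :
    fderiv ℝ (affineChart i) v (i.insertNth (0 : 𝕂) fun j => v i * y j) = y := by
  let w : Fin (n + 1) → 𝕂 := i.insertNth 0 fun j => v i * y j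
  have haffine (t : ℝ) : affineChart i (v + t • w) = affineChart i v + t • y := by
    ext j
    simp only [affineChart, w, Pi.add_apply, Pi.smul_apply, Fin.insertNth_apply_succAbove,
      Fin.insertNth_apply_same, smul_zero, add_zero, PiLp.add_apply, PiLp.smul_apply]
    rw [add_div, ← mul_smul_comm, mul_div_cancel_left₀ _ hi]
  have hchart := ((contDiffAt_affineChart hi).differentiableAt (by simp)).hasFDerivAt
  have hline := hchart.hasLineDerivAt w
  simp only [HasLineDerivAt, haffine] at hline
  refine hline.unique ?_
  simpa using ((hasDerivAt_id (0 : ℝ)).smul_const y).const_add (affineChart i v)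

theorem isSmoothSubmersionAt_affineChart (hi : v i ≠ 0) :
    IsSmoothSubmersionAt (affineChart i) v where
  eventually_contDiffAt := by
    filter_upwards [(continuous_apply i).continuousAt.eventually_ne hi] with w hw
    exact contDiffAt_affineChart hw
  surjective_fderiv y := ⟨_, fderiv_affineChart_insertNth hi y⟩

section

variable {F : Type*} [NormedAddCommGroup F] [NormedSpace ℝ F] {g : EuclideanSpace 𝕂 (Fin n) → F}

theorem eventually_mem_projectiveCone_iff (hi : v i ≠ 0) :
    ∀ᶠ w in 𝓝 v, w ∈ projectiveCone X ↔ affineChart i w ∈ affineEmbedding i ⁻¹' X :=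
  ((continuous_apply i).continuousAt.eventually_ne hi).mono fun _ => mem_projectiveCone_iff

theorem IsLocalEquationAt.comp_affineChart
    (hg : IsLocalEquationAt g (affineEmbedding i ⁻¹' X) (affineChart i v)) (hi : v i ≠ 0) :
    IsLocalEquationAt (g ∘ affineChart i) (projectiveCone X) v :=
  hg.comp (isSmoothSubmersionAt_affineChart hi) (eventually_mem_projectiveCone_iff hi)

theorem IsLocalEquationAt.tangentSubspace_projectiveCone [FiniteDimensional ℝ F]
    (hg : IsLocalEquationAt g (affineEmbedding i ⁻¹' X) (affineChart i v)) (hi : v i ≠ 0) :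
    tangentSubspace (projectiveCone X) v =
      (tangentSubspace (affineEmbedding i ⁻¹' X) (affineChart i v)).comap
        (fderiv ℝ (affineChart i) v).toLinearMap := by
  rw [(hg.comp_affineChart hi).tangentSubspace_eq, hg.tangentSubspace_eq,
    fderiv_comp v hg.hasFDerivAt.differentiableAt
      (isSmoothSubmersionAt_affineChart hi).hasFDerivAt.differentiableAt]
  rfl

end

theorem exists_apply_ne_zero_of_mem_projectiveCone (hv : v ∈ projectiveCone X) : ∃ i, v i ≠ 0 :=
  Function.ne_iff.1 hv.1

theorem IsProjectiveSubmanifold.exists_isLocalEquationAt_projectiveCone {d : ℕ}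
    (hX : IsProjectiveSubmanifold X d) (hv : v ∈ projectiveCone X) :
    ∃ (c : ℕ) (g : (Fin (n + 1) → 𝕂) → EuclideanSpace ℝ (Fin c)),
      IsLocalEquationAt g (projectiveCone X) v ∧
        finrank ℝ (EuclideanSpace 𝕂 (Fin n)) = d + c := by
  obtain ⟨i, hi⟩ := exists_apply_ne_zero_of_mem_projectiveCone hv
  obtain ⟨c, g, hg, hc⟩ :=
    (hX i _ ((mem_projectiveCone_iff hi).1 hv)).exists_isLocalEquationAt
  exact ⟨c, _, hg.comp_affineChart hi, hc⟩

theorem ProjectiveTransverse.tangentSubspace_projectiveCone_sup_eq_top {d : ℕ}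
    (htrans : ProjectiveTransverse X (hyperplaneAtInfinity 𝕂 n)) (hX : IsProjectiveSubmanifold X d)
    (hv : v ∈ projectiveCone X) :
    tangentSubspace (projectiveCone X) v ⊔
      (LinearMap.proj (R := ℝ) (φ := fun _ => 𝕂) (Fin.last n)).ker = ⊤ := by
  refine Submodule.eq_top_iff'.2 fun w => ?_
  obtain hlast | hlast := ne_or_eq (v (Fin.last n)) 0
  -- Away from the hyperplane the radial direction suffices.
  · rw [← add_sub_cancel ((w (Fin.last n) / v (Fin.last n)) • v) w]
    refine Submodule.add_mem_sup (smul_self_mem_tangentSubspace_projectiveCone hv _) ?_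
    simp [hlast]
  · obtain ⟨i, hi⟩ := exists_apply_ne_zero_of_mem_projectiveCone hv
    obtain ⟨k, hk⟩ := Fin.exists_succAbove_eq (x := Fin.last n) (y := i)
      fun h => hi (h ▸ hlast)
    have hvX := (mem_projectiveCone_iff hi).1 hv
    have hvH : affineEmbedding i (affineChart i v) ∈ hyperplaneAtInfinity 𝕂 n := by
      rwa [affineEmbedding_affineChart hv.1 hi, mk_mem_hyperplaneAtInfinity_iff]
    obtain ⟨c, g, hg, -⟩ := (hX i _ hvX).exists_isLocalEquationAt
    obtain ⟨y, hy, z, hz, hyz⟩ := Submodule.mem_sup.1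
      ((htrans i _ ⟨hvX, hvH⟩).symm ▸ Submodule.mem_top (x := fderiv ℝ (affineChart i) v w))
    let u : Fin (n + 1) → 𝕂 := i.insertNth 0 fun j => v i * z j
    have hu : fderiv ℝ (affineChart i) v u = z := fderiv_affineChart_insertNth hi z
    have hulast : u (Fin.last n) = 0 := by
      simp [u, ← hk, apply_eq_zero_of_mem_tangentSubspace_hyperplaneAtInfinity hk hvH hz]
    have hwu : w - u ∈ tangentSubspace (projectiveCone X) v := by
      rw [hg.tangentSubspace_projectiveCone hi, Submodule.mem_comap]
      simpa [hu, ← hyz] using hy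
    exact sub_add_cancel w u ▸ Submodule.add_mem_sup hwu hulast

end ProjectiveCone

section TraceAtInfinity

variable {𝕂 : Type*} [RCLike 𝕂] {n d : ℕ} {X : Set (ℙ 𝕂 (Fin (n + 1) → 𝕂))}
  {p : ℝ × EuclideanSpace 𝕂 (Fin n)}

variable (𝕂 n) in
/-- The homogeneous coordinates `[u : r]` of the point of `𝕂ℙⁿ` that corresponds to `(r, u)`: this
is the point `u / r` of `𝕂ⁿ` if `r ≠ 0`, and the point at infinity in the direction `u` if
`r = 0`. -/
def homogenize : ℝ × EuclideanSpace 𝕂 (Fin n) →L[ℝ] Fin (n + 1) → 𝕂 where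
  toFun p := Fin.snoc (α := fun _ => 𝕂) p.2 (p.1 : 𝕂)
  map_add' p q := by
    ext j
    cases j using Fin.lastCases <;> simp
  map_smul' t p := by
    ext j
    cases j using Fin.lastCases <;> simp [RCLike.real_smul_eq_coe_mul]
  cont := by fun_prop

@[simp]
theorem homogenize_apply_last : homogenize 𝕂 n p (Fin.last n) = p.1 :=
  Fin.snoc_last (α := fun _ => 𝕂) ..

@[simp]
theorem homogenize_apply_castSucc (j : Fin n) : homogenize 𝕂 n p j.castSucc = p.2 j :=
  Fin.snoc_castSucc (α := fun _ => 𝕂) ..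

theorem homogenize_ne_zero (hp : p.2 ≠ 0) : homogenize 𝕂 n p ≠ 0 := fun h =>
  hp <| PiLp.ext fun j => by simpa using congrFun h j.castSucc

theorem exists_homogenize_eq {w : Fin (n + 1) → 𝕂} (hw : w (Fin.last n) = 0) :
    ∃ u, homogenize 𝕂 n (0, u) = w := by
  refine ⟨WithLp.toLp 2 fun j => w j.castSucc, ?_⟩
  ext j
  cases j using Fin.lastCases <;> simp [hw]

theorem homogenize_mem_projectiveCone_iff (hp : p.1 ≠ 0) :
    homogenize 𝕂 n p ∈ projectiveCone X ↔ p.1⁻¹ • p.2 ∈ affinePart X := by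
  have hlast : homogenize 𝕂 n p (Fin.last n) ≠ 0 := by simpa
  rw [mem_projectiveCone_iff hlast, affinePart]
  congr! 1
  ext j
  simp [affineChart, div_eq_inv_mul, RCLike.real_smul_eq_coe_mul]

/-- The set of all `(r, u)` in the chart `[0,∞) × S` such that the point `[u : r]` belongs to `X`.
-/
def traceAtInfinity (X : Set (ℙ 𝕂 (Fin (n + 1) → 𝕂))) : Set (ℝ × EuclideanSpace 𝕂 (Fin n)) :=
  chartAtInfinity _ ∩ homogenize 𝕂 n ⁻¹' projectiveCone X

theorem isClosed_traceAtInfinity (hX : IsClosed X) : IsClosed (traceAtInfinity X) := by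
  convert isClosed_chartAtInfinity.inter
    ((isClosed_insert_zero_projectiveCone hX).preimage (homogenize 𝕂 n).continuous) using 1
  ext p
  refine and_congr_right fun hp => (or_iff_right (homogenize_ne_zero ?_)).symm
  exact norm_ne_zero_iff.1 ((mem_chartAtInfinity_iff.1 hp).2 ▸ one_ne_zero)

section LocalEquations

variable {F : Type*} [NormedAddCommGroup F] [NormedSpace ℝ F]
  {g : (Fin (n + 1) → 𝕂) → F}

theorem hasFDerivAt_comp_homogenize
    (hg : IsLocalEquationAt g (projectiveCone X) (homogenize 𝕂 n p)) :
    HasFDerivAt (g ∘ homogenize 𝕂 n) (fderiv ℝ g (homogenize 𝕂 n p) ∘L homogenize 𝕂 n) p :=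
  hg.hasFDerivAt.comp p (homogenize 𝕂 n).hasFDerivAt

variable [FiniteDimensional ℝ F]

theorem fderiv_comp_homogenize_self
    (hg : IsLocalEquationAt g (projectiveCone X) (homogenize 𝕂 n p)) :
    fderiv ℝ (g ∘ homogenize 𝕂 n) p p = 0 := by
  rw [(hasFDerivAt_comp_homogenize hg).fderiv]
  have h := smul_self_mem_tangentSubspace_projectiveCone hg.mem (1 : 𝕂)
  rwa [one_smul, hg.tangentSubspace_eq] at h

theorem isSmoothSubmersionAt_fst_comp_homogenize
    (hg : IsLocalEquationAt g (projectiveCone X) (homogenize 𝕂 n p))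
    (ht : tangentSubspace (projectiveCone X) (homogenize 𝕂 n p) ⊔
      (LinearMap.proj (R := ℝ) (φ := fun _ => 𝕂) (Fin.last n)).ker = ⊤) :
    IsSmoothSubmersionAt (fun q => (q.1, (g ∘ homogenize 𝕂 n) q)) p where
  eventually_contDiffAt := by
    filter_upwards [(homogenize 𝕂 n).continuous.continuousAt.eventually hg.eventually_contDiffAt]
      with q hq
    exact contDiffAt_fst.prodMk (hq.comp q (homogenize 𝕂 n).contDiff.contDiffAt)
  surjective_fderiv := by
    rw [(hasFDerivAt_fst.prodMk (hasFDerivAt_comp_homogenize hg)).fderiv]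
    rintro ⟨a, b⟩
    obtain ⟨w, hw⟩ := hg.surjective_fderiv
      (b - fderiv ℝ g (homogenize 𝕂 n p) (homogenize 𝕂 n (a, 0)))
    obtain ⟨y, hy, z, hz, rfl⟩ := Submodule.mem_sup.1 (ht.symm ▸ Submodule.mem_top (x := w))
    obtain ⟨u, rfl⟩ := exists_homogenize_eq hz
    rw [hg.tangentSubspace_eq] at hy
    have hgy : fderiv ℝ g (homogenize 𝕂 n p) y = 0 := hy
    have hb : fderiv ℝ g (homogenize 𝕂 n p) (homogenize 𝕂 n (0, u)) =
        b - fderiv ℝ g (homogenize 𝕂 n p) (homogenize 𝕂 n (a, 0)) := by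
      rw [← hw, map_add, hgy, zero_add]
    refine ⟨(a, 0) + (0, u), Prod.ext (by simp) ?_⟩
    simp [-Prod.mk_add_mk, hb]

theorem isLocalEquationAt_traceAtInfinity
    (hg : IsLocalEquationAt g (projectiveCone X) (homogenize 𝕂 n p))
    (ht : tangentSubspace (projectiveCone X) (homogenize 𝕂 n p) ⊔
      (LinearMap.proj (R := ℝ) (φ := fun _ => 𝕂) (Fin.last n)).ker = ⊤)
    (hp : p ∈ chartAtInfinity _) (hp1 : 0 < p.1) :
    IsLocalEquationAt (fun q => (cylinderFun q, (g ∘ homogenize 𝕂 n) q)) (traceAtInfinity X) p where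
  toIsSmoothSubmersionAt := isSmoothSubmersionAt_cylinderFun_prodMk
    (isSmoothSubmersionAt_fst_comp_homogenize hg ht).snd
    (mem_chartAtInfinity_iff.1 hp).2 (fderiv_comp_homogenize_self hg)
  apply_eq_zero := Prod.ext (cylinderFun_eq_zero_iff.2 (mem_chartAtInfinity_iff.1 hp).2)
    hg.apply_eq_zero
  eventually_mem_iff := by
    filter_upwards [continuousAt_fst.eventually (lt_mem_nhds hp1),
      (homogenize 𝕂 n).continuous.continuousAt.eventually hg.eventually_mem_iff] with q hq hqg
    simp [traceAtInfinity, mem_chartAtInfinity_iff, hqg, hq.le, cylinderFun_eq_zero_iff]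

theorem isLocalBoundaryEquationAt_traceAtInfinity
    (hg : IsLocalEquationAt g (projectiveCone X) (homogenize 𝕂 n p))
    (ht : tangentSubspace (projectiveCone X) (homogenize 𝕂 n p) ⊔
      (LinearMap.proj (R := ℝ) (φ := fun _ => 𝕂) (Fin.last n)).ker = ⊤)
    (hp : p ∈ sphereAtInfinity _) :
    IsLocalBoundaryEquationAt Prod.fst (fun q => (cylinderFun q, (g ∘ homogenize 𝕂 n) q))
      (traceAtInfinity X) p where
  toIsSmoothSubmersionAt := by
    obtain ⟨hp1, hp2⟩ := mem_sphereAtInfinity_iff.1 hp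
    have hsub := isSmoothSubmersionAt_fst_comp_homogenize hg ht
    have hker : fderiv ℝ (fun q => (q.1, (g ∘ homogenize 𝕂 n) q)) p p = 0 := by
      rw [(hasFDerivAt_fst.prodMk hsub.snd.hasFDerivAt).fderiv]
      exact Prod.ext hp1 (fderiv_comp_homogenize_self hg)
    let swap : ℝ × ℝ × F →L[ℝ] ℝ × ℝ × F :=
      (ContinuousLinearMap.fst ℝ ℝ F ∘L ContinuousLinearMap.snd ℝ ℝ (ℝ × F)).prod
        ((ContinuousLinearMap.fst ℝ ℝ (ℝ × F)).prod
          (ContinuousLinearMap.snd ℝ ℝ F ∘L ContinuousLinearMap.snd ℝ ℝ (ℝ × F)))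
    have hswap : Function.Surjective swap := fun ⟨a, b, c⟩ => ⟨(b, a, c), rfl⟩
    exact (isSmoothSubmersionAt_continuousLinearMap hswap _).comp
      (isSmoothSubmersionAt_cylinderFun_prodMk hsub hp2 hker)
  boundary_apply_eq_zero := (mem_sphereAtInfinity_iff.1 hp).1
  apply_eq_zero := Prod.ext (cylinderFun_eq_zero_iff.2 (mem_sphereAtInfinity_iff.1 hp).2)
    hg.apply_eq_zero
  eventually_mem_iff := by
    filter_upwards [(homogenize 𝕂 n).continuous.continuousAt.eventually hg.eventually_mem_iff]
      with q hqg
    simp [traceAtInfinity, mem_chartAtInfinity_iff, hqg, cylinderFun_eq_zero_iff, and_assoc]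

end LocalEquations

theorem setOf_smul_mem_affinePart_eq :
    {p : ℝ × EuclideanSpace 𝕂 (Fin n) | 0 < p.1 ∧ ‖p.2‖ = 1 ∧ p.1⁻¹ • p.2 ∈ affinePart X} =
      traceAtInfinity X ∩ {p | 0 < p.1} := by
  ext p
  constructor
  · rintro ⟨hp1, hp2, hpX⟩
    exact ⟨⟨mem_chartAtInfinity_iff.2 ⟨hp1.le, hp2⟩,
      (homogenize_mem_projectiveCone_iff hp1.ne').2 hpX⟩, hp1⟩
  · rintro ⟨⟨hp, hpX⟩, hp1 : 0 < p.1⟩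
    exact ⟨hp1, (mem_chartAtInfinity_iff.1 hp).2,
      (homogenize_mem_projectiveCone_iff hp1.ne').1 hpX⟩

theorem exists_isLocalEquationAt_traceAtInfinity (hX : IsProjectiveSubmanifold X d)
    (htrans : ProjectiveTransverse X (hyperplaneAtInfinity 𝕂 n))
    (hp : p ∈ traceAtInfinity X) (hp1 : 0 < p.1) :
    ∃ (c : ℕ) (g : ℝ × EuclideanSpace 𝕂 (Fin n) → ℝ × EuclideanSpace ℝ (Fin c)),
      IsLocalEquationAt g (traceAtInfinity X) p ∧
        finrank ℝ (ℝ × EuclideanSpace 𝕂 (Fin n)) =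
          d + finrank ℝ (ℝ × EuclideanSpace ℝ (Fin c)) := by
  obtain ⟨c, g, hg, hd⟩ := hX.exists_isLocalEquationAt_projectiveCone hp.2
  have ht := htrans.tangentSubspace_projectiveCone_sup_eq_top hX hp.2
  refine ⟨c, _, isLocalEquationAt_traceAtInfinity hg ht hp.1 hp1, ?_⟩
  simp [finrank_prod, hd, add_left_comm]

theorem exists_isLocalBoundaryEquationAt_traceAtInfinity (hX : IsProjectiveSubmanifold X d)
    (htrans : ProjectiveTransverse X (hyperplaneAtInfinity 𝕂 n))
    (hp : p ∈ traceAtInfinity X) (hp0 : p ∈ sphereAtInfinity _) :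
    ∃ (c : ℕ) (g : ℝ × EuclideanSpace 𝕂 (Fin n) → ℝ × EuclideanSpace ℝ (Fin c)),
      IsLocalBoundaryEquationAt Prod.fst g (traceAtInfinity X) p ∧
        finrank ℝ (ℝ × EuclideanSpace 𝕂 (Fin n)) =
          d + finrank ℝ (ℝ × EuclideanSpace ℝ (Fin c)) := by
  obtain ⟨c, g, hg, hd⟩ := hX.exists_isLocalEquationAt_projectiveCone hp.2
  have ht := htrans.tangentSubspace_projectiveCone_sup_eq_top hX hp.2
  refine ⟨c, _, isLocalBoundaryEquationAt_traceAtInfinity hg ht hp0, ?_⟩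
  simp [finrank_prod, hd, add_left_comm]

theorem mem_sphereAtInfinity_or_fst_pos (hp : p ∈ traceAtInfinity X) :
    p ∈ sphereAtInfinity _ ∨ 0 < p.1 :=
  have ⟨hp1, hp2⟩ := mem_chartAtInfinity_iff.1 hp.1
  hp1.eq_or_lt.imp (fun h => mem_sphereAtInfinity_iff.2 ⟨h.symm, hp2⟩) id

theorem closureAtInfinity_affinePart (hclosed : IsClosed X) (hX : IsProjectiveSubmanifold X d)
    (htrans : ProjectiveTransverse X (hyperplaneAtInfinity 𝕂 n)) :
    closureAtInfinity (affinePart X) = traceAtInfinity X := by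
  rw [closureAtInfinity, setOf_smul_mem_affinePart_eq]
  refine (closure_minimal inter_subset_left (isClosed_traceAtInfinity hclosed)).antisymm
    fun p hp => ?_
  obtain hp0 | hp1 := mem_sphereAtInfinity_or_fst_pos hp
  · obtain ⟨_, _, hg, -⟩ := exists_isLocalBoundaryEquationAt_traceAtInfinity hX htrans hp hp0
    exact hg.mem_closure
  · exact subset_closure ⟨hp, hp1⟩

theorem submanifoldBoundary_traceAtInfinity (hX : IsProjectiveSubmanifold X d)
    (htrans : ProjectiveTransverse X (hyperplaneAtInfinity 𝕂 n)) :
    submanifoldBoundary (traceAtInfinity X) d = traceAtInfinity X ∩ sphereAtInfinity _ := by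
  ext p
  constructor
  · intro hp
    refine ⟨hp.1, (mem_sphereAtInfinity_or_fst_pos hp.1).resolve_right fun hp1 => ?_⟩
    obtain ⟨_, _, hg, -⟩ := exists_isLocalEquationAt_traceAtInfinity hX htrans hp.1 hp1
    exact hg.not_isBoundaryPoint hp
  · rintro ⟨hp, hp0⟩
    obtain ⟨_, _, hg, hd⟩ := exists_isLocalBoundaryEquationAt_traceAtInfinity hX htrans hp hp0
    exact hg.isBoundaryPoint hd

theorem isPSubmanifold_traceAtInfinity (hX : IsProjectiveSubmanifold X d)
    (htrans : ProjectiveTransverse X (hyperplaneAtInfinity 𝕂 n)) :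
    IsPSubmanifold (chartAtInfinity _) (sphereAtInfinity _) (traceAtInfinity X) d := by
  have hbdry := submanifoldBoundary_traceAtInfinity hX htrans
  refine ⟨inter_subset_left, fun p hp => ?_, hbdry, fun p hp => ?_⟩
  · obtain hp0 | hp1 := mem_sphereAtInfinity_or_fst_pos hp
    · exact .inr (hbdry.ge ⟨hp, hp0⟩)
    · obtain ⟨_, _, hg, hd⟩ := exists_isLocalEquationAt_traceAtInfinity hX htrans hp hp1
      exact .inl (hg.isInteriorPoint hd)
  · obtain ⟨hpX, hp0⟩ := hbdry.le hp
    obtain ⟨_, _, hg, -⟩ := exists_isLocalBoundaryEquationAt_traceAtInfinity hX htrans hpX hp0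
    exact hg.tangentSubspace_sup_eq (isLocalBoundaryEquationAt_chartAtInfinity hp0)
      (isLocalEquationAt_sphereAtInfinity hp0) inter_subset_left

end TraceAtInfinity

theorem lemma4p2_general {𝕂 : Type*} [RCLike 𝕂] {n d : ℕ}
    {X : Set (ℙ 𝕂 (Fin (n + 1) → 𝕂))} (hclosed : IsClosed X) (hX : IsProjectiveSubmanifold X d)
    (htrans : ProjectiveTransverse X (hyperplaneAtInfinity 𝕂 n)) :
    IsConicAtInfinity (affinePart X) := by
  refine or_iff_not_imp_left.2 fun hunbounded =>
    ⟨asymptoticSet_nonempty hunbounded, univ, isOpen_univ, subset_univ _, d, ?_⟩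
  rw [closureAtInfinity_affinePart hclosed hX htrans, inter_univ, inter_univ, inter_univ]
  exact isPSubmanifold_traceAtInfinity hX htrans

theorem lemma4p2 {𝕂 : Type*} [RCLike 𝕂] (n d : ℕ)
    (X : Set (ℙ 𝕂 (Fin (n + 1) → 𝕂)))
    (hclosed : IsClosed X) (hconn : IsConnected X)
    (hX : IsProjectiveSubmanifold X d)
    (hdim : 0 < d) (hcodim : d < Module.finrank ℝ (EuclideanSpace 𝕂 (Fin n)))
    (hmeet : (X ∩ hyperplaneAtInfinity 𝕂 n).Nonempty)
    (htrans : ProjectiveTransverse X (hyperplaneAtInfinity 𝕂 n)) :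
    IsConicAtInfinity (affinePart X) :=
  lemma4p2_general hclosed hX htrans
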